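/- Let $N$ be a connected smooth manifold with a Riemannian metric $h$, let $H$ be a smooth function on $\mathbb{R}\times N$, and let $A(u)$, $u\in\mathbb{R}$, be a family of one-forms on $N$ depending smoothly on $(u,x)$. Consider the $(N,h)$p-wave $(M,g)$ given by these data, that is, $M=\mathbb{R}^2\times N$ with coordinates $(u,v,x)$ and the Lorentzian metric of signature $(-,+,\dots,+)$ $$g = 2\,du\,dv + H(u,x)\,du^2 + 2A(u)\,du + h ,$$ where $2A(u)\,du$ denotes the symmetric form $A(u)\otimes du+du\otimes A(u)$, time-oriented so that the null vector field $\partial_v$ is past-directed. A nonzero tangent vector $X$ is called timelike if $g(X,X)<0$, lightlike if $g(X,X)=0$, and causal if it is timelike or lightlike. Then: 1. $(M,g)$ is causal, i.e. it contains no closed causal curve: there is no piecewise $C^1$ curve $\gamma\colon[a,b]\to M$, $a<b$, with $\gamma(a)=\gamma(b)$, whose velocities (both one-sided velocities at a break point) are all future-directed causal, or all past-directed causal. 2. The coordinate function $u\colon M\to\mathbb{R}$ is a quasi-time function, i.e. it is smooth, $\nabla u$ is everywhere nonzero, causal and past-directed, and every null geodesic segment (a geodesic $\gamma\colon[a,b]\to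 M$, $a<b$, with everywhere lightlike velocity) along which $u$ is constant is injective. -/

import Mathlib

open Bundle Set
open scoped Manifold ContDiff Topology

noncomputable section

section Lorentz

variable {V : Type*} [NormedAddCommGroup V] [NormedSpace ℝ V]
  {K : Type*} [TopologicalSpace K] (I : ModelWithCorners ℝ V K)
  (M : Type*) [TopologicalSpace M] [ChartedSpace K M] [IsManifold I ∞ M]

/-- A smooth Lorentzian metric on `M`, with signature `(-, +, …, +)`. -/
structure LorentzianMetric where
  /-- The scalar product on each tangent space. -/
  inner (p : M) : TangentSpace I p →L[ℝ] TangentSpace I p →L[ℝ] ℝ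
  symm (p : M) (X Y : TangentSpace I p) : inner p X Y = inner p Y X
  /-- There is a negative direction, on whose orthogonal complement the metric is
  positive definite. -/
  signature (p : M) : ∃ T : TangentSpace I p, inner p T T < 0 ∧
    ∀ X : TangentSpace I p, inner p T X = 0 → X ≠ 0 → 0 < inner p X X
  contMDiff : ContMDiff I (I.prod 𝓘(ℝ, V →L[ℝ] V →L[ℝ] ℝ)) ∞
    (fun p : M ↦ TotalSpace.mk' (V →L[ℝ] V →L[ℝ] ℝ)
      (E := fun p : M ↦ TangentSpace I p →L[ℝ] TangentSpace I p →L[ℝ] ℝ) p (inner p))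

variable {I M}

namespace LorentzianMetric

variable (g : LorentzianMetric I M)

def IsTimelike {p : M} (X : TangentSpace I p) : Prop := g.inner p X X < 0

/-- Nonzero null vectors; the zero vector is not lightlike. -/
def IsLightlike {p : M} (X : TangentSpace I p) : Prop := X ≠ 0 ∧ g.inner p X X = 0

def IsCausalVector {p : M} (X : TangentSpace I p) : Prop := g.IsTimelike X ∨ g.IsLightlike X

/-- A time orientation, given by a continuous global timelike vector field (which is declared to
be future-directed). -/
structure TimeOrientation where
  /-- The timelike vector field. -/
  field (p : M) : TangentSpace I p
  continuous : Continuous (fun p : M ↦ (⟨p, field p⟩ : TangentBundle I M))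
  timelike (p : M) : g.IsTimelike (field p)

variable {g} in
/-- A causal vector in the same time cone as the time-orienting vector. -/
def TimeOrientation.FutureDirected (τ : g.TimeOrientation) {p : M} (X : TangentSpace I p) : Prop :=
  g.IsCausalVector X ∧ g.inner p X (τ.field p) < 0

variable {g} in
/-- A causal vector in the time cone opposite to the time-orienting vector. -/
def TimeOrientation.PastDirected (τ : g.TimeOrientation) {p : M} (X : TangentSpace I p) : Prop :=
  g.IsCausalVector X ∧ 0 < g.inner p X (τ.field p)

end LorentzianMetric

/-- The velocity at time `s` of a curve `γ` defined on the set `J` of times (one-sided at the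
end points of an interval `J`). -/
def velocityWithin (I : ModelWithCorners ℝ V K) {M : Type*} [TopologicalSpace M] [ChartedSpace K M]
    (γ : ℝ → M) (J : Set ℝ) (s : ℝ) : TangentSpace I (γ s) :=
  mfderivWithin 𝓘(ℝ, ℝ) I γ J s (1 : ℝ)

namespace LorentzianMetric

variable (g : LorentzianMetric I M)

/-- `γ : [a, b] → M` is piecewise continuously differentiable, and all its velocities (both
one-sided velocities at a break point) satisfy the property `P`. -/
def PiecewiseWithVelocity (P : ∀ p : M, TangentSpace I p → Prop) (γ : ℝ → M) (a b : ℝ) : Prop :=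
  ∃ (n : ℕ) (t : ℕ → ℝ), t 0 = a ∧ t n = b ∧ ∀ i < n, t i < t (i + 1) ∧
    ContMDiffOn 𝓘(ℝ, ℝ) I 1 γ (Icc (t i) (t (i + 1))) ∧
    ∀ s ∈ Icc (t i) (t (i + 1)), P (γ s) (velocityWithin I γ (Icc (t i) (t (i + 1))) s)

variable {g} in
/-- A causal curve `γ : [a, b] → M`: piecewise `C¹`, and either everywhere future-directed causal
or everywhere past-directed causal. -/
def IsCausalCurve (τ : g.TimeOrientation) (γ : ℝ → M) (a b : ℝ) : Prop :=
  PiecewiseWithVelocity (fun _ X ↦ τ.FutureDirected X) γ a b ∨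
  PiecewiseWithVelocity (fun _ X ↦ τ.PastDirected X) γ a b

variable {g} in
/-- The spacetime is causal: there is no closed causal curve. -/
def IsCausal (τ : g.TimeOrientation) : Prop :=
  ¬ ∃ (γ : ℝ → M) (a b : ℝ), a < b ∧ IsCausalCurve τ γ a b ∧ γ a = γ b

/-- `X` is the gradient of `f` at `p`: `g(X, Y) = df(Y)` for all `Y` in the tangent space.
Since `g` is nondegenerate, at most one vector has this property. -/
def IsGradientAt (f : M → ℝ) (p : M) (X : TangentSpace I p) : Prop :=
  ∀ Y : TangentSpace I p, g.inner p X Y = mfderiv I 𝓘(ℝ, ℝ) f p Y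

/-- The component `g(a, b)` of the metric in the chart around `q`, as a function of the point `y`
of the coordinate space; `a` and `b` are vectors of the coordinate space. -/
def chartComponent (q : M) (a b : V) (y : V) : ℝ :=
  g.inner ((extChartAt I q).symm y)
    (mfderivWithin 𝓘(ℝ, V) I (extChartAt I q).symm (range I) y a)
    (mfderivWithin 𝓘(ℝ, V) I (extChartAt I q).symm (range I) y b)

/-- The Christoffel symbols of the first kind of the Levi-Civita connection in the chart
around `q`: `½ (∂_a g(b, c) + ∂_b g(a, c) - ∂_c g(a, b))`, which is `g(∇_a b, c)` for the constant
coordinate vector fields `a`, `b`, `c`. -/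
def christoffel (q : M) (a b c : V) (y : V) : ℝ :=
  (fderivWithin ℝ (g.chartComponent q b c) (range I) y a
    + fderivWithin ℝ (g.chartComponent q a c) (range I) y b
    - fderivWithin ℝ (g.chartComponent q a b) (range I) y c) / 2

/-- `γ : [a, b] → M` is a geodesic segment: it is `C²` and in each of the charts around points
of `M` its coordinate expression `y` satisfies the geodesic equation `∇_{y'} y' = 0`, written
here with the index lowered as `g(y'', c) + Γ(y', y', c) = 0` for all `c`. -/
def IsGeodesicSegment (γ : ℝ → M) (a b : ℝ) : Prop :=
  a < b ∧ ContMDiffOn 𝓘(ℝ, ℝ) I 2 γ (Icc a b) ∧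
  ∀ q : M, ∀ s ∈ Icc a b, γ s ∈ (chartAt K q).source → ∀ c : V,
    let y : ℝ → V := fun r ↦ extChartAt I q (γ r)
    let y' : ℝ → V := derivWithin y (Icc a b)
    let y'' : ℝ → V := derivWithin y' (Icc a b)
    g.chartComponent q (y'' s) c (y s) + g.christoffel q (y' s) (y' s) c (y s) = 0

/-- A null geodesic segment: a geodesic segment with lightlike (in particular nonzero)
velocity. -/
def IsNullGeodesicSegment (γ : ℝ → M) (a b : ℝ) : Prop :=
  g.IsGeodesicSegment γ a b ∧
    ∀ s ∈ Icc a b, g.IsLightlike (velocityWithin I γ (Icc a b) s)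

variable {g} in
/-- A quasi-time function: a smooth function whose gradient is everywhere nonzero, causal and
past-directed, and such that every null geodesic segment along which it is constant is
injective. -/
def IsQuasiTimeFunction (τ : g.TimeOrientation) (f : M → ℝ) : Prop :=
  ContMDiff I 𝓘(ℝ, ℝ) ∞ f ∧
  (∀ p : M, ∃ X : TangentSpace I p,
    g.IsGradientAt f p X ∧ X ≠ 0 ∧ g.IsCausalVector X ∧ τ.PastDirected X) ∧
  ∀ (γ : ℝ → M) (a b : ℝ), g.IsNullGeodesicSegment γ a b →
    (∃ c : ℝ, ∀ s ∈ Icc a b, f (γ s) = c) → InjOn γ (Icc a b)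

end LorentzianMetric

/-- A field of linear maps out of the tangent spaces is smooth if its values on smooth vector
fields are. -/
lemma contMDiffAt_hom_of_apply [FiniteDimensional ℝ V]
    {F : Type*} [NormedAddCommGroup F] [NormedSpace ℝ F]
    {W : M → Type*} [∀ p, AddCommGroup (W p)] [∀ p, Module ℝ (W p)]
    [TopologicalSpace (TotalSpace F W)] [∀ p, TopologicalSpace (W p)]
    [∀ p, IsTopologicalAddGroup (W p)] [∀ p, ContinuousSMul ℝ (W p)]
    [FiberBundle F W] [VectorBundle ℝ F W]
    (B : (p : M) → TangentSpace I p →L[ℝ] W p) (p₀ : M)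
    (hB : ∀ (X : (p : M) → TangentSpace I p),
      ContMDiffAt I (I.prod 𝓘(ℝ, V)) ∞ (fun p ↦ (⟨p, X p⟩ : TangentBundle I M)) p₀ →
      ContMDiffAt I (I.prod 𝓘(ℝ, F)) ∞ (fun p ↦ TotalSpace.mk' F p (B p (X p))) p₀) :
    ContMDiffAt I (I.prod 𝓘(ℝ, V →L[ℝ] F)) ∞
      (fun p : M ↦ TotalSpace.mk' (V →L[ℝ] F)
        (E := fun p : M ↦ TangentSpace I p →L[ℝ] W p) p (B p)) p₀ := by
  rw [contMDiffAt_hom_bundle]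
  refine ⟨contMDiffAt_id, ?_⟩
  set e := trivializationAt V (TangentSpace I) p₀
  have hp₀ : p₀ ∈ e.baseSet := FiberBundle.mem_baseSet_trivializationAt' p₀
  have key : ∀ v : V, ContMDiffAt I 𝓘(ℝ, F) ∞
      (fun p ↦ ContinuousLinearMap.inCoordinates V (TangentSpace I) F W p₀ p p₀ p (B p) v) p₀ := by
    intro v
    have hX : ContMDiffAt I (I.prod 𝓘(ℝ, V)) ∞
        (fun p ↦ (⟨p, e.symmL ℝ p v⟩ : TangentBundle I M)) p₀ := by
      rw [contMDiffAt_section]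
      refine (contMDiffAt_const (c := v)).congr_of_eventuallyEq ?_
      filter_upwards [e.open_baseSet.mem_nhds hp₀] with p hp
      have := e.apply_mk_symm hp v
      rw [e.symmL_apply hp]
      exact congrArg Prod.snd this
    have := hB _ hX
    rw [contMDiffAt_section] at this
    refine this.congr_of_eventuallyEq ?_
    have hopen := (trivializationAt F W p₀).open_baseSet.mem_nhds
      (FiberBundle.mem_baseSet_trivializationAt' p₀)
    filter_upwards [hopen] with p hp
    simp only [ContinuousLinearMap.inCoordinates, ContinuousLinearMap.comp_apply]
    rw [Trivialization.continuousLinearMapAt_apply, Trivialization.coe_linearMapAt_of_mem _ hp]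
  let b := Module.finBasis ℝ V
  have hsum : ∀ L : V →L[ℝ] F, L = ∑ i,
      ContinuousLinearMap.smulRightL ℝ V F (LinearMap.toContinuousLinearMap (b.coord i))
        (L (b i)) := by
    intro L
    ext v
    conv_lhs => rw [← b.sum_repr v, map_sum]
    simp
  have : (fun p ↦ ContinuousLinearMap.inCoordinates V (TangentSpace I) F W p₀ p p₀ p (B p)) =
      fun p ↦ ∑ i, ContinuousLinearMap.smulRightL ℝ V F
        (LinearMap.toContinuousLinearMap (b.coord i))
        (ContinuousLinearMap.inCoordinates V (TangentSpace I) F W p₀ p p₀ p (B p) (b i)) := by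
    funext p
    exact hsum _
  rw [this]
  refine contMDiffAt_finsetSum fun i _ ↦ ?_
  exact (ContinuousLinearMap.contMDiff _).contMDiffAt.comp p₀ (key (b i))

/-- A field of bilinear forms is smooth if its values on pairs of smooth vector fields are. -/
lemma contMDiff_form_of_apply [FiniteDimensional ℝ V]
    (B : (p : M) → TangentSpace I p →L[ℝ] TangentSpace I p →L[ℝ] ℝ)
    (hB : ∀ (p₀ : M) (X Y : (p : M) → TangentSpace I p),
      ContMDiffAt I (I.prod 𝓘(ℝ, V)) ∞ (fun p ↦ (⟨p, X p⟩ : TangentBundle I M)) p₀ →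
      ContMDiffAt I (I.prod 𝓘(ℝ, V)) ∞ (fun p ↦ (⟨p, Y p⟩ : TangentBundle I M)) p₀ →
      ContMDiffAt I 𝓘(ℝ, ℝ) ∞ (fun p ↦ B p (X p) (Y p)) p₀) :
    ContMDiff I (I.prod 𝓘(ℝ, V →L[ℝ] V →L[ℝ] ℝ)) ∞
      (fun p : M ↦ TotalSpace.mk' (V →L[ℝ] V →L[ℝ] ℝ)
        (E := fun p : M ↦ TangentSpace I p →L[ℝ] TangentSpace I p →L[ℝ] ℝ) p (B p)) := by
  intro p₀
  refine contMDiffAt_hom_of_apply (W := fun p : M ↦ TangentSpace I p →L[ℝ] ℝ) B p₀ fun X hX ↦ ?_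
  refine contMDiffAt_hom_of_apply (W := Bundle.Trivial M ℝ) (fun p ↦ B p (X p)) p₀ fun Y hY ↦ ?_
  rw [contMDiffAt_section]
  exact hB p₀ X Y hX hY

end Lorentz

section Wave

variable (E : Type*) [NormedAddCommGroup E] [NormedSpace ℝ E]
  (N : Type*) [TopologicalSpace N] [ChartedSpace E N] [IsManifold 𝓘(ℝ, E) ∞ N]

/-- The model with corners of `ℝ × ℝ × N`, with coordinates `(u, v, x)`. -/
abbrev waveModel : ModelWithCorners ℝ (ℝ × ℝ × E) (ModelProd ℝ (ModelProd ℝ E)) :=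
  𝓘(ℝ, ℝ).prod (𝓘(ℝ, ℝ).prod 𝓘(ℝ, E))

/-- An `(N, h)`p-wave is the manifold `ℝ × ℝ × N`, with coordinates `(u, v, x)`, carrying the metric
`2 du dv + H(u) du² + 2 A(u) du + h`. This structure holds the data of such a wave: a Riemannian metric `h` on `N`, a smooth function `H(u, x)`, and
a `u`-dependent one-form `A(u)` on `N`, smooth in `(u, x)`. -/
structure NhpWave where
  /-- The Riemannian metric on the wavefront. -/
  h : ContMDiffRiemannianMetric 𝓘(ℝ, E) ∞ E (fun x : N ↦ TangentSpace 𝓘(ℝ, E) x)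
  /-- The characteristic function. -/
  H : ℝ → N → ℝ
  contMDiff_H : ContMDiff (𝓘(ℝ, ℝ).prod 𝓘(ℝ, E)) 𝓘(ℝ, ℝ) ∞ (fun z : ℝ × N ↦ H z.1 z.2)
  /-- The one-form of the mixed terms. -/
  A : ℝ → (x : N) → TangentSpace 𝓘(ℝ, E) x →L[ℝ] ℝ
  contMDiff_A : ContMDiff (𝓘(ℝ, ℝ).prod 𝓘(ℝ, E)) (𝓘(ℝ, E).prod 𝓘(ℝ, E →L[ℝ] ℝ)) ∞
    (fun z : ℝ × N ↦ TotalSpace.mk' (E →L[ℝ] ℝ)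
      (E := fun x : N ↦ TangentSpace 𝓘(ℝ, E) x →L[ℝ] ℝ) z.2 (A z.1 z.2))

variable {E N}

/-- The bilinear form `2 du dv + H du² + 2 A du + h` on `ℝ × ℝ × E`. -/
def waveForm (H : ℝ) (A : E →L[ℝ] ℝ) (h : E →L[ℝ] E →L[ℝ] ℝ) :
    (ℝ × ℝ × E) →L[ℝ] (ℝ × ℝ × E) →L[ℝ] ℝ :=
  let du : (ℝ × ℝ × E) →L[ℝ] ℝ := ContinuousLinearMap.fst ℝ ℝ (ℝ × E)
  let dv : (ℝ × ℝ × E) →L[ℝ] ℝ :=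
    (ContinuousLinearMap.fst ℝ ℝ E).comp (ContinuousLinearMap.snd ℝ ℝ (ℝ × E))
  let dx : (ℝ × ℝ × E) →L[ℝ] E :=
    (ContinuousLinearMap.snd ℝ ℝ E).comp (ContinuousLinearMap.snd ℝ ℝ (ℝ × E))
  du.smulRight dv + dv.smulRight du + H • du.smulRight du
    + du.smulRight (A.comp dx) + (A.comp dx).smulRight du + h.bilinearComp dx dx

lemma waveForm_apply (H : ℝ) (A : E →L[ℝ] ℝ) (h : E →L[ℝ] E →L[ℝ] ℝ) (X Y : ℝ × ℝ × E) :
    waveForm H A h X Y = X.1 * Y.2.1 + X.2.1 * Y.1 + H * (X.1 * Y.1)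
      + (X.1 * A Y.2.2 + A X.2.2 * Y.1) + h X.2.2 Y.2.2 := by
  simp [waveForm]
  ring


lemma waveForm_symm (H : ℝ) (A : E →L[ℝ] ℝ) (h : E →L[ℝ] E →L[ℝ] ℝ) (hs : ∀ a b, h a b = h b a)
    (X Y : ℝ × ℝ × E) : waveForm H A h X Y = waveForm H A h Y X := by
  rw [waveForm_apply, waveForm_apply, hs]
  ring

/-- The vector `∂_u - (H + 1) / 2 ∂_v`. -/
def waveTimelike (H : ℝ) : ℝ × ℝ × E := (1, -((H + 1) / 2), 0)

lemma waveForm_timelike (H : ℝ) (A : E →L[ℝ] ℝ) (h : E →L[ℝ] E →L[ℝ] ℝ) :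
    waveForm H A h (waveTimelike H) (waveTimelike H) < 0 := by
  rw [waveForm_apply]
  simp [waveTimelike]
  linarith

lemma waveForm_pos (H : ℝ) (A : E →L[ℝ] ℝ) (h : E →L[ℝ] E →L[ℝ] ℝ) (hp : ∀ a, a ≠ 0 → 0 < h a a)
    (X : ℝ × ℝ × E) (hX : waveForm H A h (waveTimelike H) X = 0) (h0 : X ≠ 0) :
    0 < waveForm H A h X X := by
  obtain ⟨a, b, ξ⟩ := X
  rw [waveForm_apply] at hX ⊢
  simp only [waveTimelike, map_zero, zero_apply] at hX ⊢
  have hb : b = (1 - H) / 2 * a - A ξ := by linarith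
  have he : a * b + b * a + H * (a * a) + (a * A ξ + A ξ * a) + h ξ ξ = a ^ 2 + h ξ ξ := by
    rw [hb]
    ring
  rw [he]
  by_cases hξ : ξ = 0
  · have ha : a ≠ 0 := by
      rintro rfl
      apply h0
      simp [hb, hξ]
    have := sq_pos_of_ne_zero ha
    simpa [hξ] using this
  · have := hp ξ hξ
    positivity

lemma contMDiffAt_wave_u {p₀ : ℝ × ℝ × N} {X : (p : ℝ × ℝ × N) → TangentSpace (waveModel E) p}
    (hX : ContMDiffAt (waveModel E) ((waveModel E).prod 𝓘(ℝ, ℝ × ℝ × E)) ∞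
      (fun p ↦ (⟨p, X p⟩ : TangentBundle (waveModel E) (ℝ × ℝ × N))) p₀) :
    ContMDiffAt (waveModel E) 𝓘(ℝ, ℝ) ∞ (fun p ↦ (X p).1) p₀ := by
  have h1 := (contMDiff_fst (I := 𝓘(ℝ, ℝ)) (J := 𝓘(ℝ, ℝ).prod 𝓘(ℝ, E)) (M := ℝ) (N := ℝ × N)
    (n := ∞)).contMDiff_tangentMap (m := ∞) le_rfl
  have h2 := ((contMDiff_snd_tangentBundle_modelSpace ℝ 𝓘(ℝ, ℝ)).comp h1).contMDiffAt.comp p₀ hX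
  refine h2.congr_of_eventuallyEq (Filter.Eventually.of_forall fun p ↦ ?_)
  simp only [Function.comp, tangentMap, mfderiv_fst]
  rfl

lemma contMDiffAt_wave_tail {p₀ : ℝ × ℝ × N} {X : (p : ℝ × ℝ × N) → TangentSpace (waveModel E) p}
    (hX : ContMDiffAt (waveModel E) ((waveModel E).prod 𝓘(ℝ, ℝ × ℝ × E)) ∞
      (fun p ↦ (⟨p, X p⟩ : TangentBundle (waveModel E) (ℝ × ℝ × N))) p₀) :
    ContMDiffAt (waveModel E) ((𝓘(ℝ, ℝ).prod 𝓘(ℝ, E)).prod 𝓘(ℝ, ℝ × E)) ∞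
      (fun p ↦ (⟨p.2, (X p).2⟩ : TangentBundle (𝓘(ℝ, ℝ).prod 𝓘(ℝ, E)) (ℝ × N))) p₀ := by
  have h1 := (contMDiff_snd (I := 𝓘(ℝ, ℝ)) (J := 𝓘(ℝ, ℝ).prod 𝓘(ℝ, E)) (M := ℝ) (N := ℝ × N)
    (n := ∞)).contMDiff_tangentMap (m := ∞) le_rfl
  have h2 := h1.contMDiffAt.comp p₀ hX
  refine h2.congr_of_eventuallyEq (Filter.Eventually.of_forall fun p ↦ ?_)
  simp only [Function.comp, tangentMap, mfderiv_snd]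
  rfl

lemma contMDiffAt_wave_v {p₀ : ℝ × ℝ × N} {X : (p : ℝ × ℝ × N) → TangentSpace (waveModel E) p}
    (hX : ContMDiffAt (waveModel E) ((waveModel E).prod 𝓘(ℝ, ℝ × ℝ × E)) ∞
      (fun p ↦ (⟨p, X p⟩ : TangentBundle (waveModel E) (ℝ × ℝ × N))) p₀) :
    ContMDiffAt (waveModel E) 𝓘(ℝ, ℝ) ∞ (fun p ↦ (X p).2.1) p₀ := by
  have h1 := (contMDiff_fst (I := 𝓘(ℝ, ℝ)) (J := 𝓘(ℝ, E)) (M := ℝ) (N := N)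
    (n := ∞)).contMDiff_tangentMap (m := ∞) le_rfl
  have h2 := ((contMDiff_snd_tangentBundle_modelSpace ℝ 𝓘(ℝ, ℝ)).comp h1).contMDiffAt.comp p₀
    (contMDiffAt_wave_tail hX)
  refine h2.congr_of_eventuallyEq (Filter.Eventually.of_forall fun p ↦ ?_)
  simp only [Function.comp, tangentMap, mfderiv_fst]
  rfl

lemma contMDiffAt_wave_x {p₀ : ℝ × ℝ × N} {X : (p : ℝ × ℝ × N) → TangentSpace (waveModel E) p}
    (hX : ContMDiffAt (waveModel E) ((waveModel E).prod 𝓘(ℝ, ℝ × ℝ × E)) ∞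
      (fun p ↦ (⟨p, X p⟩ : TangentBundle (waveModel E) (ℝ × ℝ × N))) p₀) :
    ContMDiffAt (waveModel E) (𝓘(ℝ, E).prod 𝓘(ℝ, E)) ∞
      (fun p ↦ (⟨p.2.2, (X p).2.2⟩ : TangentBundle 𝓘(ℝ, E) N)) p₀ := by
  have h1 := (contMDiff_snd (I := 𝓘(ℝ, ℝ)) (J := 𝓘(ℝ, E)) (M := ℝ) (N := N)
    (n := ∞)).contMDiff_tangentMap (m := ∞) le_rfl
  have h2 := h1.contMDiffAt.comp p₀ (contMDiffAt_wave_tail hX)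
  refine h2.congr_of_eventuallyEq (Filter.Eventually.of_forall fun p ↦ ?_)
  simp only [Function.comp, tangentMap, mfderiv_snd]
  rfl

/-- The metric `g = 2 du dv + H(u) du² + 2 A(u) du + h` on `ℝ × ℝ × N`. -/
def NhpWave.metric [FiniteDimensional ℝ E] (W : NhpWave E N) : LorentzianMetric (waveModel E) (ℝ × ℝ × N) where
  inner p := waveForm (E := E) (W.H p.1 p.2.2) (W.A p.1 p.2.2) (W.h.inner p.2.2)
  symm p X Y := waveForm_symm (E := E) _ _ _ (W.h.symm p.2.2) X Y
  signature p := ⟨waveTimelike (W.H p.1 p.2.2), waveForm_timelike (E := E) _ _ _,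
    waveForm_pos (E := E) _ _ _ (W.h.pos p.2.2)⟩
  contMDiff := by
    refine contMDiff_form_of_apply _ fun p₀ X Y hX hY ↦ ?_
    have hux : ContMDiff (waveModel E) (𝓘(ℝ, ℝ).prod 𝓘(ℝ, E)) ∞
        (fun p : ℝ × ℝ × N ↦ (p.1, p.2.2)) :=
      contMDiff_fst.prodMk (contMDiff_snd.comp contMDiff_snd)
    have hH : ContMDiffAt (waveModel E) 𝓘(ℝ, ℝ) ∞ (fun p : ℝ × ℝ × N ↦ W.H p.1 p.2.2) p₀ :=
      (W.contMDiff_H.comp hux).contMDiffAt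
    have hA (Z : (p : ℝ × ℝ × N) → TangentSpace (waveModel E) p)
        (hZ : ContMDiffAt (waveModel E) ((waveModel E).prod 𝓘(ℝ, ℝ × ℝ × E)) ∞
          (fun p ↦ (⟨p, Z p⟩ : TangentBundle (waveModel E) (ℝ × ℝ × N))) p₀) :
        ContMDiffAt (waveModel E) 𝓘(ℝ, ℝ) ∞
          (fun p : ℝ × ℝ × N ↦ W.A p.1 p.2.2 (Z p).2.2) p₀ := by
      have h := ContMDiffAt.clm_bundle_apply (F₁ := E) (F₂ := ℝ)
        (E₁ := fun x : N ↦ TangentSpace 𝓘(ℝ, E) x) (E₂ := Bundle.Trivial N ℝ)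
        (b := fun p : ℝ × ℝ × N ↦ p.2.2)
        (ϕ := fun p ↦ W.A p.1 p.2.2) (v := fun p ↦ (Z p).2.2)
        (W.contMDiff_A.comp hux).contMDiffAt (contMDiffAt_wave_x hZ)
      simp only [contMDiffAt_totalSpace] at h
      exact h.2
    have hh : ContMDiffAt (waveModel E) 𝓘(ℝ, ℝ) ∞
          (fun p : ℝ × ℝ × N ↦ W.h.inner p.2.2 (X p).2.2 (Y p).2.2) p₀ := by
      have h := ContMDiffAt.clm_bundle_apply₂ (F₁ := E) (F₂ := E) (F₃ := ℝ)
        (E₁ := fun x : N ↦ TangentSpace 𝓘(ℝ, E) x) (E₂ := fun x : N ↦ TangentSpace 𝓘(ℝ, E) x)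
        (E₃ := Bundle.Trivial N ℝ)
        (b := fun p : ℝ × ℝ × N ↦ p.2.2)
        (ψ := fun p ↦ W.h.inner p.2.2) (v := fun p ↦ (X p).2.2) (w := fun p ↦ (Y p).2.2)
        (W.h.contMDiff.comp (contMDiff_snd.comp contMDiff_snd)).contMDiffAt
        (contMDiffAt_wave_x hX) (contMDiffAt_wave_x hY)
      simp only [contMDiffAt_totalSpace] at h
      exact h.2
    have hs := ((((contMDiffAt_wave_u hX).mul (contMDiffAt_wave_v hY)).add
      ((contMDiffAt_wave_v hX).mul (contMDiffAt_wave_u hY))).add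
      (hH.mul ((contMDiffAt_wave_u hX).mul (contMDiffAt_wave_u hY)))).add
      (((contMDiffAt_wave_u hX).mul (hA Y hY)).add ((hA X hX).mul (contMDiffAt_wave_u hY)))
    refine (hs.add hh).congr_of_eventuallyEq (Filter.Eventually.of_forall fun p ↦ ?_)
    exact waveForm_apply (E := E) _ _ _ (X p) (Y p)

variable (E N) in
/-- The coordinate vector field `∂_v`. -/
def coordV (p : ℝ × ℝ × N) : TangentSpace (waveModel E) p := ((0, 1, 0) : ℝ × ℝ × E)

lemma contMDiff_scalar_section (f : ℝ × ℝ × N → ℝ) (c : ℝ × ℝ × N → ℝ)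
    (hf : ContMDiff (waveModel E) 𝓘(ℝ, ℝ) ∞ f) (hc : ContMDiff (waveModel E) 𝓘(ℝ, ℝ) ∞ c) :
    ContMDiff (waveModel E) (𝓘(ℝ, ℝ).prod 𝓘(ℝ, ℝ)) ∞
      (fun p ↦ (⟨f p, c p⟩ : TangentBundle 𝓘(ℝ, ℝ) ℝ)) := by
  intro p
  rw [contMDiffAt_totalSpace]
  refine ⟨hf p, (hc p).congr_of_eventuallyEq (Filter.Eventually.of_forall fun q ↦ ?_)⟩
  simp

/-- An `(N, h)`p-wave carries a time orientation for which `∂_v` is past-directed. -/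
theorem NhpWave.exists_timeOrientation [FiniteDimensional ℝ E] (W : NhpWave E N) :
    ∃ τ : W.metric.TimeOrientation, ∀ p, τ.PastDirected (coordV E N p) := by
  have hux : ContMDiff (waveModel E) (𝓘(ℝ, ℝ).prod 𝓘(ℝ, E)) ∞
      (fun p : ℝ × ℝ × N ↦ (p.1, p.2.2)) :=
    contMDiff_fst.prodMk (contMDiff_snd.comp contMDiff_snd)
  have hH : ContMDiff (waveModel E) 𝓘(ℝ, ℝ) ∞ (fun p : ℝ × ℝ × N ↦ W.H p.1 p.2.2) :=
    W.contMDiff_H.comp hux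
  have hc : ContMDiff (waveModel E) 𝓘(ℝ, ℝ) ∞
      (fun p : ℝ × ℝ × N ↦ -((W.H p.1 p.2.2 + 1) / 2)) := by
    have h2 : ContDiff ℝ ∞ (fun r : ℝ ↦ -((r + 1) / 2)) := by fun_prop
    exact h2.contMDiff.comp hH
  have h1 := contMDiff_scalar_section (E := E) (N := N) (fun p ↦ p.1) (fun _ ↦ 1)
    contMDiff_fst contMDiff_const
  have h2 := contMDiff_scalar_section (E := E) (N := N) (fun p ↦ p.2.1) _
    (contMDiff_fst.comp contMDiff_snd) hc
  have h3 : ContMDiff (waveModel E) (𝓘(ℝ, E).prod 𝓘(ℝ, E)) ∞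
      (fun p : ℝ × ℝ × N ↦ (⟨p.2.2, 0⟩ : TangentBundle 𝓘(ℝ, E) N)) :=
    (Bundle.contMDiff_zeroSection ℝ (TangentSpace 𝓘(ℝ, E) (M := N))).comp
      (contMDiff_snd.comp contMDiff_snd)
  have h23 := contMDiff_equivTangentBundleProd_symm.comp (h2.prodMk h3)
  have h123 := contMDiff_equivTangentBundleProd_symm.comp (h1.prodMk h23)
  refine ⟨⟨fun p ↦ waveTimelike (W.H p.1 p.2.2), h123.continuous,
    fun p ↦ waveForm_timelike (E := E) _ _ _⟩, fun p ↦ ⟨Or.inr ⟨?_, ?_⟩, ?_⟩⟩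
  · intro h
    have : ((0, 1, 0) : ℝ × ℝ × E) = 0 := h
    simp at this
  · refine (waveForm_apply (E := E) _ _ _ _ _).trans ?_
    simp [coordV]
  · refine lt_of_lt_of_eq ?_ (waveForm_apply (E := E) _ _ _ _ _).symm
    have h0 : W.A p.1 p.2.2 (0 : E) = 0 := map_zero (W.A p.1 p.2.2)
    simp only [coordV, waveTimelike]
    norm_num
    exact zero_lt_one.trans_eq ((add_zero 1).symm.trans (congrArg (1 + ·) h0.symm))

end Wave
end

/-! The null field `∂_v` satisfies g(∂_v, X) = du(X), so it is the gradient of u. On vectors with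
du(X) = 0 the metric reduces to h, which is positive definite on the N-component; hence the only
causal vectors tangent to a level set of u are the nonzero multiples of `∂_v`.

Since `∂_v` is past-directed, a future-directed X has du(X) ≥ 0, and if du(X) = 0 then X is a
negative multiple of `∂_v` (`waveForm_lex`). Thus (u, -v) strictly increases in the lexicographic
order across each piece of a future-directed curve (`toLex_lt_toLex_of_hasDerivWithinAt`), and such
a curve cannot close up; past-directed curves follow by changing signs.

For the quasi-time property, a lightlike curve in a level set of u has velocity a nonzero multiple
of `∂_v`. Then v has nonvanishing derivative along it, and Rolle's theorem makes v, hence the curve,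
injective. -/

section Calculus

/-! ### One-variable calculus on a closed interval -/

/-- If `f` is nondecreasing and `k` has positive derivative wherever `f` has zero derivative, then
`(f, k)` increases lexicographically between the end points. -/
lemma toLex_lt_toLex_of_hasDerivWithinAt {f k f' k' : ℝ → ℝ} {a b : ℝ} (hab : a < b)
    (hf : ∀ s ∈ Icc a b, HasDerivWithinAt f (f' s) (Icc a b) s)
    (hk : ∀ s ∈ Icc a b, HasDerivWithinAt k (k' s) (Icc a b) s)
    (hf' : ∀ s ∈ Icc a b, 0 ≤ f' s) (hk' : ∀ s ∈ Icc a b, f' s = 0 → 0 < k' s) :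
    toLex (f a, k a) < toLex (f b, k b) := by
  have hmono : MonotoneOn f (Icc a b) :=
    monotoneOn_of_hasDerivWithinAt_nonneg (convex_Icc a b)
      (fun s hs ↦ (hf s hs).continuousWithinAt)
      (fun s hs ↦ (hf s (interior_subset hs)).mono interior_subset)
      (fun s hs ↦ hf' s (interior_subset hs))
  have ha := left_mem_Icc.2 hab.le
  have hb := right_mem_Icc.2 hab.le
  rw [Prod.Lex.toLex_lt_toLex]
  rcases (hmono ha hb hab.le).lt_or_eq with hlt | heq
  · exact Or.inl hlt
  refine Or.inr ⟨heq, ?_⟩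
  -- A monotone function with equal end values is constant, so `f'` vanishes everywhere and the
  -- hypothesis on `k'` applies on the whole interval.
  have hconst : ∀ s ∈ Icc a b, f s = f a := fun s hs ↦
    le_antisymm ((hmono hs hb hs.2).trans_eq heq.symm) (hmono ha hs hs.1)
  have hzero : ∀ s ∈ Icc a b, f' s = 0 := fun s hs ↦
    (uniqueDiffOn_Icc hab s hs).eq_deriv _ (hf s hs)
      ((hasDerivWithinAt_const s _ (f a)).congr hconst (hconst s hs))
  exact strictMonoOn_of_hasDerivWithinAt_pos (convex_Icc a b)
    (fun s hs ↦ (hk s hs).continuousWithinAt)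
    (fun s hs ↦ (hk s (interior_subset hs)).mono interior_subset)
    (fun s hs ↦ hk' s (interior_subset hs) (hzero s (interior_subset hs))) ha hb hab

/-- A function on an interval whose derivative does not vanish is injective. -/
lemma injOn_Icc_of_hasDerivWithinAt_ne_zero {f f' : ℝ → ℝ} {a b : ℝ}
    (hf : ∀ s ∈ Icc a b, HasDerivWithinAt f (f' s) (Icc a b) s)
    (hf' : ∀ s ∈ Icc a b, f' s ≠ 0) : InjOn f (Icc a b) := by
  have key : ∀ s ∈ Icc a b, ∀ t ∈ Icc a b, s < t → f s ≠ f t := by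
    intro s hs t ht hst heq
    have hsub : Icc s t ⊆ Icc a b := Icc_subset_Icc hs.1 ht.2
    -- Rolle's theorem on the subinterval between two points with equal values.
    obtain ⟨c, hc, hc0⟩ := exists_hasDerivAt_eq_zero hst
      (fun r hr ↦ ((hf r (hsub hr)).mono hsub).continuousWithinAt) heq
      (fun r hr ↦ ((hf r (hsub (Ioo_subset_Icc_self hr))).mono hsub).hasDerivAt
        (Icc_mem_nhds hr.1 hr.2))
    exact hf' c (hsub (Ioo_subset_Icc_self hc)) hc0
  intro s hs t ht heq
  rcases lt_trichotomy s t with h | h | h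
  · exact (key s hs t ht h heq).elim
  · exact h
  · exact (key t ht s hs h heq.symm).elim

end Calculus

/-! ### Causal vectors of the wave form on a single tangent space -/

section WaveForm

variable {E : Type*} [NormedAddCommGroup E] [NormedSpace ℝ E]
  {H : ℝ} {A : E →L[ℝ] ℝ} {h : E →L[ℝ] E →L[ℝ] ℝ}

/-- The product with `∂_v` is the component `du`. -/
lemma waveForm_coordV_left (X : ℝ × ℝ × E) : waveForm H A h (0, 1, 0) X = X.1 := by
  simp [waveForm_apply]

lemma waveForm_neg_left (X Y : ℝ × ℝ × E) : waveForm H A h (-X) Y = -waveForm H A h X Y := by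
  simp

lemma waveForm_neg_neg (X : ℝ × ℝ × E) : waveForm H A h (-X) (-X) = waveForm H A h X X := by
  simp

/-- A causal vector tangent to the wavefronts `u = const` is proportional to `∂_v`. -/
lemma eq_smul_coordV_of_waveForm_nonpos (hp : ∀ a, a ≠ 0 → 0 < h a a) {X : ℝ × ℝ × E}
    (hX : waveForm H A h X X ≤ 0) (hu : X.1 = 0) : X = X.2.1 • ((0, 1, 0) : ℝ × ℝ × E) := by
  obtain ⟨a, b, ξ⟩ := X
  obtain rfl : a = 0 := hu
  have hξ : ξ = 0 := by
    by_contra hne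
    have := hp ξ hne
    simp [waveForm_apply] at hX
    linarith
  simp [hξ]

/-- Causal vectors in the time cone opposite to `∂_v` have nonnegative component `du`. -/
lemma waveForm_fst_nonneg (hs : ∀ a b, h a b = h b a) (hp : ∀ a, a ≠ 0 → 0 < h a a)
    {X T : ℝ × ℝ × E} (hX : waveForm H A h X X ≤ 0) (hT : waveForm H A h T T < 0)
    (hT1 : 0 < T.1) (hXT : waveForm H A h X T < 0) : 0 ≤ X.1 := by
  by_contra! hneg
  -- This combination cancels the du-component, so the form on `Z` is just h and is nonnegative. If
  -- `X.1 < 0 < T.1`, every term of the bilinear expansion is nonpositive, the last two strictly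
  -- negative: a contradiction.
  set Z := T.1 • X - X.1 • T with hZ
  have hZ1 : Z.1 = 0 := by
    simp [hZ, mul_comm]
  have hZZ : 0 ≤ waveForm H A h Z Z := by
    have hh : waveForm H A h Z Z = h Z.2.2 Z.2.2 := by
      simp [waveForm_apply, hZ1]
    rw [hh]
    by_cases h0 : Z.2.2 = 0
    · simp [h0]
    · exact (hp _ h0).le
  have hexp : waveForm H A h Z Z = T.1 ^ 2 * waveForm H A h X X
      - 2 * (T.1 * X.1) * waveForm H A h X T + X.1 ^ 2 * waveForm H A h T T := by
    rw [hZ]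
    simp only [map_sub, map_smul, sub_apply, smul_apply, smul_eq_mul,
      waveForm_symm H A h hs T X]
    ring
  have h1 : T.1 ^ 2 * waveForm H A h X X ≤ 0 := mul_nonpos_of_nonneg_of_nonpos (sq_nonneg _) hX
  have h2 : 0 < T.1 * X.1 * waveForm H A h X T :=
    mul_pos_of_neg_of_neg (mul_neg_of_pos_of_neg hT1 hneg) hXT
  have h3 : X.1 ^ 2 * waveForm H A h T T < 0 :=
    mul_neg_of_pos_of_neg (sq_pos_of_neg hneg) hT
  linarith

/-- Along causal vectors in the time cone opposite to `∂_v`, the coordinate `u` does not decrease,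
and `v` decreases if `u` is stationary. -/
lemma waveForm_lex (hs : ∀ a b, h a b = h b a) (hp : ∀ a, a ≠ 0 → 0 < h a a)
    {X T : ℝ × ℝ × E} (hX : waveForm H A h X X ≤ 0) (hT : waveForm H A h T T < 0)
    (hT1 : 0 < T.1) (hXT : waveForm H A h X T < 0) : 0 ≤ X.1 ∧ (X.1 = 0 → X.2.1 < 0) := by
  refine ⟨waveForm_fst_nonneg hs hp hX hT hT1 hXT, fun hu ↦ ?_⟩
  -- Here `X` is its v-component times `∂_v`, so its product with `T` is `X.2.1 * T.1`, which is
  -- negative while `T.1` is positive.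
  rw [eq_smul_coordV_of_waveForm_nonpos hp hX hu, map_smul, smul_apply,
    waveForm_coordV_left, smul_eq_mul] at hXT
  exact neg_of_mul_neg_left hXT hT1.le

end WaveForm

/-! ### Coordinates along curves -/

section Wave

variable {E : Type*} [NormedAddCommGroup E] [NormedSpace ℝ E]
  {N : Type*} [TopologicalSpace N] [ChartedSpace E N]

/-- The component `du` of the velocity is the derivative of the coordinate `u`. -/
lemma hasDerivWithinAt_coord_u {γ : ℝ → ℝ × ℝ × N} {J : Set ℝ} {s : ℝ}
    (hγ : MDifferentiableWithinAt 𝓘(ℝ, ℝ) (waveModel E) γ J s) :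
    HasDerivWithinAt (fun r ↦ (γ r).1) (velocityWithin (waveModel E) γ J s).1 J s := by
  have h : HasFDerivWithinAt (fun r ↦ (γ r).1) ((ContinuousLinearMap.fst ℝ ℝ (ℝ × E)).comp
      (mfderivWithin 𝓘(ℝ, ℝ) (waveModel E) γ J s : ℝ →L[ℝ] ℝ × ℝ × E)) J s :=
    (HasMFDerivAt.comp_hasMFDerivWithinAt (I := 𝓘(ℝ, ℝ)) (I' := waveModel E) (I'' := 𝓘(ℝ, ℝ)) s
      (hasMFDerivAt_fst (γ s)) hγ.hasMFDerivWithinAt).hasFDerivWithinAt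
  exact h.hasDerivWithinAt

/-- The component `dv` of the velocity is the derivative of the coordinate `v`. -/
lemma hasDerivWithinAt_coord_v {γ : ℝ → ℝ × ℝ × N} {J : Set ℝ} {s : ℝ}
    (hγ : MDifferentiableWithinAt 𝓘(ℝ, ℝ) (waveModel E) γ J s) :
    HasDerivWithinAt (fun r ↦ (γ r).2.1) (velocityWithin (waveModel E) γ J s).2.1 J s := by
  have h : HasFDerivWithinAt (fun r ↦ (γ r).2.1) ((ContinuousLinearMap.fst ℝ ℝ E).comp
      ((ContinuousLinearMap.snd ℝ ℝ (ℝ × E)).comp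
        (mfderivWithin 𝓘(ℝ, ℝ) (waveModel E) γ J s : ℝ →L[ℝ] ℝ × ℝ × E))) J s :=
    (HasMFDerivAt.comp_hasMFDerivWithinAt (I := 𝓘(ℝ, ℝ)) (I' := 𝓘(ℝ, ℝ).prod 𝓘(ℝ, E))
      (I'' := 𝓘(ℝ, ℝ)) s (hasMFDerivAt_fst (γ s).2)
      (HasMFDerivAt.comp_hasMFDerivWithinAt (I := 𝓘(ℝ, ℝ)) (I' := waveModel E) s
        (hasMFDerivAt_snd (γ s)) hγ.hasMFDerivWithinAt)).hasFDerivWithinAt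
  exact h.hasDerivWithinAt

/-- If along a piecewise `C¹` curve `ε u` is nondecreasing and `ε v` has negative derivative
where `u` is stationary, then the curve is not closed. -/
lemma LorentzianMetric.PiecewiseWithVelocity.ne_of_lex
    {P : ∀ p : ℝ × ℝ × N, TangentSpace (waveModel E) p → Prop} (ε : ℝ)
    (hP : ∀ (p : ℝ × ℝ × N) (X : ℝ × ℝ × E), P p X →
      0 ≤ ε * X.1 ∧ (ε * X.1 = 0 → ε * X.2.1 < 0))
    {γ : ℝ → ℝ × ℝ × N} {a b : ℝ} (hab : a < b)
    (hγ : LorentzianMetric.PiecewiseWithVelocity P γ a b) : γ a ≠ γ b := by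
  obtain ⟨n, t, rfl, rfl, ht⟩ := hγ
  -- The second entry carries a minus sign because `ε v` decreases when u is stationary. The cases
  -- `ε = 1` and `ε = -1` serve future- and past-directed curves.
  let F : ℝ → ℝ ×ₗ ℝ := fun s ↦ toLex (ε * (γ s).1, -ε * (γ s).2.1)
  have hstep : ∀ i < n, F (t i) < F (t (i + 1)) := by
    intro i hi
    obtain ⟨hlt, hC, hvel⟩ := ht i hi
    have hd := hC.mdifferentiableOn one_ne_zero
    exact toLex_lt_toLex_of_hasDerivWithinAt hlt
      (fun s hs ↦ (hasDerivWithinAt_coord_u (hd s hs)).const_mul ε)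
      (fun s hs ↦ (hasDerivWithinAt_coord_v (hd s hs)).const_mul (-ε))
      (fun s hs ↦ (hP _ _ (hvel s hs)).1) (fun s hs h0 ↦ by
        rw [neg_mul]
        exact neg_pos.2 ((hP _ _ (hvel s hs)).2 h0))
  have hle : ∀ m, m < n → F (t 0) < F (t (m + 1)) := by
    intro m
    induction m with
    | zero => exact hstep 0
    | succ k ih => exact fun hk ↦ (ih (by omega)).trans (hstep _ hk)
  -- With no pieces the two end points would be the same time `t 0`, against `a < b`.
  have hn : n ≠ 0 := by
    rintro rfl
    exact lt_irrefl _ hab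
  obtain ⟨m, rfl⟩ := Nat.exists_eq_succ_of_ne_zero hn
  intro heq
  refine (hle m (Nat.lt_succ_self m)).ne ?_
  simp only [F]
  rw [heq]

variable [IsManifold 𝓘(ℝ, E) ∞ N]

/-! ### Causality and the quasi-time function -/

namespace NhpWave

variable [FiniteDimensional ℝ E] (W : NhpWave E N)

lemma metric_nonpos_of_isCausalVector {p : ℝ × ℝ × N} {X : TangentSpace (waveModel E) p}
    (hX : W.metric.IsCausalVector X) : W.metric.inner p X X ≤ 0 :=
  hX.elim le_of_lt fun h ↦ h.2.le

/-- A causal vector with vanishing component `du` is proportional to `∂_v`. -/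
lemma eq_smul_coordV_of_isCausalVector {p : ℝ × ℝ × N} {X : ℝ × ℝ × E}
    (hX : W.metric.IsCausalVector (p := p) X) (hu : X.1 = 0) :
    X = X.2.1 • ((0, 1, 0) : ℝ × ℝ × E) :=
  eq_smul_coordV_of_waveForm_nonpos (E := E) (W.h.pos p.2.2)
    (W.metric_nonpos_of_isCausalVector hX) hu

variable {W}

/-- Future-directed vectors do not decrease `u`, and decrease `v` if they keep `u` stationary. -/
lemma futureDirected_lex {τ : W.metric.TimeOrientation}
    (hτ : ∀ p : ℝ × ℝ × N, τ.PastDirected (coordV E N p)) {p : ℝ × ℝ × N} {X : ℝ × ℝ × E}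
    (hX : τ.FutureDirected (p := p) X) : 0 ≤ X.1 ∧ (X.1 = 0 → X.2.1 < 0) :=
  waveForm_lex (E := E) (W.h.symm p.2.2) (W.h.pos p.2.2)
    (W.metric_nonpos_of_isCausalVector hX.1) (τ.timelike p)
    -- That `∂_v` is past-directed says exactly that the time-orienting vector has positive
    -- du-component.
    ((hτ p).2.trans_eq (waveForm_coordV_left (E := E) _)) hX.2

/-- The quadratic form is even and the product with the time-orienting vector is odd. This transfers
the sign conditions to past-directed curves. -/
lemma futureDirected_neg {τ : W.metric.TimeOrientation} {p : ℝ × ℝ × N} {X : ℝ × ℝ × E}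
    (hX : τ.PastDirected (p := p) X) : τ.FutureDirected (p := p) (-X) := by
  have hneg : W.metric.inner p (-X) (τ.field p) = -W.metric.inner p X (τ.field p) :=
    waveForm_neg_left (E := E) X (τ.field p)
  have hsq : W.metric.inner p (-X) (-X) = W.metric.inner p X X := waveForm_neg_neg (E := E) X
  refine ⟨hX.1.imp (fun h ↦ lt_of_eq_of_lt hsq h)
    (fun h ↦ ⟨fun h0 ↦ h.1 (neg_eq_zero.1 h0), hsq.trans h.2⟩), ?_⟩
  exact lt_of_eq_of_lt hneg (neg_neg_of_pos hX.2)

lemma isCausal {τ : W.metric.TimeOrientation}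
    (hτ : ∀ p : ℝ × ℝ × N, τ.PastDirected (coordV E N p)) : LorentzianMetric.IsCausal τ := by
  rintro ⟨γ, a, b, hab, hγ | hγ, hclosed⟩
  · refine LorentzianMetric.PiecewiseWithVelocity.ne_of_lex (E := E) 1 (fun p X hX ↦ ?_)
      hab hγ hclosed
    simpa using futureDirected_lex hτ hX
  · refine LorentzianMetric.PiecewiseWithVelocity.ne_of_lex (E := E) (-1) (fun p X hX ↦ ?_)
      hab hγ hclosed
    simpa using futureDirected_lex hτ (futureDirected_neg hX)

/-- The gradient of the coordinate `u` is `∂_v`. -/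
lemma isGradientAt_coord_u (p : ℝ × ℝ × N) :
    W.metric.IsGradientAt (fun p : ℝ × ℝ × N ↦ p.1) p (coordV E N p) := by
  intro Y
  have h : mfderiv (waveModel E) 𝓘(ℝ, ℝ) (fun p : ℝ × ℝ × N ↦ p.1) p Y = (Y : ℝ × ℝ × E).1 :=
    congrArg (fun L : (ℝ × ℝ × E) →L[ℝ] ℝ ↦ L Y) (hasMFDerivAt_fst p).mfderiv
  exact (waveForm_coordV_left (E := E) Y).trans h.symm

/-- A lightlike differentiable curve along which `u` is constant is injective. -/
lemma injOn_of_coord_u_const {γ : ℝ → ℝ × ℝ × N} {a b : ℝ} (hab : a < b)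
    (hγ : MDifferentiableOn 𝓘(ℝ, ℝ) (waveModel E) γ (Icc a b))
    (hvel : ∀ s ∈ Icc a b,
      W.metric.IsLightlike (velocityWithin (waveModel E) γ (Icc a b) s))
    {c : ℝ} (hc : ∀ s ∈ Icc a b, (γ s).1 = c) : InjOn γ (Icc a b) := by
  have hv : InjOn (fun s ↦ (γ s).2.1) (Icc a b) := by
    refine injOn_Icc_of_hasDerivWithinAt_ne_zero
      -- Constancy of u makes the velocity a multiple of `∂_v` with coefficient the derivative of v;
      -- were that zero, the velocity would vanish, which lightlike vectors do not.
      (fun s hs ↦ hasDerivWithinAt_coord_v (hγ s hs)) fun s hs h0 ↦ (hvel s hs).1 ?_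
    have hu : (velocityWithin (waveModel E) γ (Icc a b) s).1 = 0 :=
      (uniqueDiffOn_Icc hab s hs).eq_deriv _ (hasDerivWithinAt_coord_u (hγ s hs))
        ((hasDerivWithinAt_const s _ c).congr hc (hc s hs))
    refine (W.eq_smul_coordV_of_isCausalVector (Or.inr (hvel s hs)) hu).trans ?_
    rw [h0]
    exact zero_smul ℝ _
  intro s hs t ht heq
  exact hv hs ht (congrArg (fun p : ℝ × ℝ × N ↦ p.2.1) heq)

lemma isQuasiTimeFunction_coord_u {τ : W.metric.TimeOrientation}
    (hτ : ∀ p : ℝ × ℝ × N, τ.PastDirected (coordV E N p)) :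
    LorentzianMetric.IsQuasiTimeFunction τ (fun p : ℝ × ℝ × N ↦ p.1) := by
  refine ⟨contMDiff_fst, fun p ↦ ⟨coordV E N p, isGradientAt_coord_u p, fun h ↦ ?_, (hτ p).1,
    hτ p⟩, ?_⟩
  · have h' : ((0, 1, 0) : ℝ × ℝ × E) = 0 := h
    simp at h'
  · rintro γ a b ⟨⟨hab, hC, -⟩, hvel⟩ ⟨c, hc⟩
    exact injOn_of_coord_u_const hab (hC.mdifferentiableOn two_ne_zero) hvel hc

end NhpWave

end Wave

theorem theorem4p6 {E : Type*} [NormedAddCommGroup E] [NormedSpace ℝ E] [FiniteDimensional ℝ E]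
    {N : Type*} [TopologicalSpace N] [ChartedSpace E N] [IsManifold 𝓘(ℝ, E) ∞ N]
    [T2Space N] [SecondCountableTopology N] [ConnectedSpace N]
    (W : NhpWave E N) (τ : W.metric.TimeOrientation)
    (hτ : ∀ p : ℝ × ℝ × N, τ.PastDirected (coordV E N p)) :
    LorentzianMetric.IsCausal τ ∧
      LorentzianMetric.IsQuasiTimeFunction τ (fun p : ℝ × ℝ × N ↦ p.1) :=
  ⟨NhpWave.isCausal hτ, NhpWave.isQuasiTimeFunction_coord_u hτ⟩
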